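/- For $k\ge 1$ let $f_k=(q^k;q^k)_\infty=\prod_{m=1}^{\infty}(1-q^{km})$, and let $a_3(n)$ denote the number of 3-regular cubic partitions of $n$, i.e. the integers $a_3(n)$, $n\ge 0$, are defined by \[\sum_{n\ge 0}a_3(n)q^n=\frac{f_3f_6}{f_1f_2}.\] Then for all integers $\alpha\ge 0$ and $n\ge 0$, \begin{align*} a_3\left(3^{2\alpha}n+\frac{3^{2\alpha}-1}{4}\right)&\equiv 0 \pmod{3^{\alpha}},\\ a_3\left(3^{2\alpha+1}n+\frac{3^{2\alpha+2}-1}{4}\right)&\equiv 0 \pmod{3^{\alpha+1}},\\ a_3\left(3^{2\alpha+2}n+\frac{7\cdot 3^{2\alpha+1}-1}{4}\right)&\equiv 0 \pmod{3^{\alpha+2}},\\ a_3\left(3^{2\alpha+2}n+\frac{11\cdot 3^{2\alpha+1}-1}{4}\right)&\equiv 0 \pmod{3^{\alpha+2}}. \end{align*} -/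

import Mathlib

open PowerSeries
open scoped PowerSeries.WithPiTopology

/-- The formal infinite product `f_k = (q^k; q^k)_∞ = ∏_{m ≥ 1} (1 - q^{k m})` as a power series
over `ℤ` in the variable `q = X` (the index `m` is shifted by one). The infinite product is taken
in the topology of coefficientwise convergence, `ℤ` being discrete. -/
noncomputable def qf (k : ℕ) : ℤ⟦X⟧ :=
  ∏' m : ℕ, (1 - X ^ (k * (m + 1)))

/-- The product defining `qf k` converges for `k ≥ 1`. -/
theorem multipliable_qf {k : ℕ} (hk : 0 < k) :
    Multipliable fun m : ℕ => (1 - X ^ (k * (m + 1)) : ℤ⟦X⟧) := by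
  simp_rw [sub_eq_add_neg]
  apply PowerSeries.WithPiTopology.multipliable_one_add_of_tendsto_order_atTop_nhds_top
  refine ENat.tendsto_nhds_top_iff_natCast_lt.mpr fun n => Filter.eventually_atTop.mpr ⟨n, ?_⟩
  intro m hm
  rw [order_neg, order_X_pow]
  have : n < k * (m + 1) := by nlinarith
  exact_mod_cast this

theorem constantCoeff_qf {k : ℕ} (hk : 0 < k) : constantCoeff (qf k) = 1 := by
  rw [qf, (multipliable_qf hk).map_tprod (constantCoeff (R := ℤ))
    (PowerSeries.WithPiTopology.continuous_constantCoeff ℤ)]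
  have h : ∀ m : ℕ, constantCoeff (1 - X ^ (k * (m + 1)) : ℤ⟦X⟧) = 1 := by
    intro m
    have : k * (m + 1) ≠ 0 := by positivity
    simp [this]
  simp [h]

/-- The generating function `f_3 f_6 / (f_1 f_2)`: the inverse is the inverse power series of
`f_1 f_2`, whose constant coefficient is `1`. -/
noncomputable def a3Series : ℤ⟦X⟧ :=
  qf 3 * qf 6 * invOfUnit (qf 1 * qf 2) 1

/-- The series `a3Series` is the quotient of `f_3 f_6` by `f_1 f_2`. -/
theorem a3Series_mul : a3Series * (qf 1 * qf 2) = qf 3 * qf 6 := by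
  rw [a3Series, mul_assoc, invOfUnit_mul, mul_one]
  simp [constantCoeff_qf]

/-- The number `a_3(n)` of 3-regular cubic partitions of `n`, defined by
`∑_{n ≥ 0} a_3(n) q^n = f_3 f_6 / (f_1 f_2)`. -/
noncomputable def a3 (n : ℕ) : ℤ := coeff n a3Series

/-! Write A = f_3 f_6/(f_1 f_2), T = q A^4 and W = q A(q) A(q^3) = q f_9 f_18/(f_1 f_2). Extraction
of every third coefficient acts on A·ℤ[3T] and A^3·ℤ[3T] as follows: the section 3n+2 maps A·ℤ[3T]
into 3A^3·ℤ[3T] (`exists_triSection_two_eq`), and the section 3n maps A^3·ℤ[3T] into A·ℤ[3T]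
(`exists_triSection_zero_eq`). Alternating the two gains one factor 3 per pair, which gives the
first two congruences. The last two gain one more: modulo 3 a polynomial in 3T is constant and A^3
is a series in q^3.

Multiplying by a series in q^3 turns both sections into the section 3n of a power of W. These traces
obey a recurrence coming from the modular equation W^3 = T(q^3)(1 + 3W + 9W^2) in
`cubicW_relations`, and `exists_triSection_cubicW_pow` tracks their powers of 3 and T.

The modular equation rests on the 3-dissection of f_1 f_2 = φ(-q)ψ(q), obtained from the Jacobi
triple product, and on computing the product of f_1 f_2 over q ↦ ωq (ω^3 = 1) in two ways: from the
infinite products and from the dissection. -/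

/-! ### Infinite products over arithmetic progressions -/

/-- The infinite product `∏_{m ≥ 0} (1 + ε q^{r + s m})`. -/
noncomputable def progProd (r s : ℕ) (ε : ℤ) : ℤ⟦X⟧ :=
  ∏' m : ℕ, (1 + C ε * X ^ (r + s * m))

theorem multipliable_progProd {r s : ℕ} (hs : 0 < s) (ε : ℤ) :
    Multipliable fun m : ℕ => (1 + C ε * X ^ (r + s * m) : ℤ⟦X⟧) := by
  apply PowerSeries.WithPiTopology.multipliable_one_add_of_tendsto_order_atTop_nhds_top
  refine ENat.tendsto_nhds_top_iff_natCast_lt.mpr fun n => Filter.eventually_atTop.mpr ⟨n + 1, ?_⟩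
  intro m hm
  refine lt_of_lt_of_le ?_ (le_order_mul (C ε) (X ^ (r + s * m)))
  rw [order_X_pow]
  have : n < r + s * m := by nlinarith
  exact lt_of_lt_of_le (by exact_mod_cast this) le_add_self

theorem qf_eq_progProd (k : ℕ) : qf k = progProd k k (-1) := by
  simp only [qf, progProd]
  congr 1
  ext1 m
  rw [map_neg, map_one, show k + k * m = k * (m + 1) by ring]
  ring

theorem tendsto_progProd {r s : ℕ} (hs : 0 < s) (ε : ℤ) :
    Filter.Tendsto (fun N => ∏ m ∈ Finset.range N, (1 + C ε * X ^ (r + s * m) : ℤ⟦X⟧))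
      Filter.atTop (nhds (progProd r s ε)) :=
  (multipliable_progProd hs ε).hasProd.tendsto_prod_nat

theorem progProd_two_split {r s : ℕ} (hs : 0 < s) (ε : ℤ) :
    progProd r s ε = progProd r (2 * s) ε * progProd (r + s) (2 * s) ε := by
  have h2 : 0 < 2 * s := by omega
  refine tendsto_nhds_unique ((tendsto_progProd (r := r) hs ε).comp
    (Filter.tendsto_id.const_mul_atTop' (show 0 < 2 by norm_num)))
    (((tendsto_progProd h2 ε).mul (tendsto_progProd h2 ε)).congr fun N => ?_)
  simp only [Function.comp, id]
  induction N with
  | zero => simp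
  | succ N ih =>
    rw [show 2 * (N + 1) = 2 * N + 1 + 1 by ring]
    simp only [Finset.prod_range_succ]
    rw [← ih, show r + s * (2 * N) = r + 2 * s * N by ring,
      show r + s * (2 * N + 1) = r + s + 2 * s * N by ring]
    ring

theorem progProd_three_split {r s : ℕ} (hs : 0 < s) (ε : ℤ) :
    progProd r s ε = progProd r (3 * s) ε * progProd (r + s) (3 * s) ε *
      progProd (r + 2 * s) (3 * s) ε := by
  have h3 : 0 < 3 * s := by omega
  refine tendsto_nhds_unique ((tendsto_progProd (r := r) hs ε).comp
    (Filter.tendsto_id.const_mul_atTop' (show 0 < 3 by norm_num)))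
    ((((tendsto_progProd h3 ε).mul (tendsto_progProd h3 ε)).mul
      (tendsto_progProd h3 ε)).congr fun N => ?_)
  simp only [Function.comp, id]
  induction N with
  | zero => simp
  | succ N ih =>
    rw [show 3 * (N + 1) = 3 * N + 1 + 1 + 1 by ring]
    simp only [Finset.prod_range_succ]
    rw [← ih, show r + s * (3 * N) = r + 3 * s * N by ring,
      show r + s * (3 * N + 1) = r + s + 3 * s * N by ring,
      show r + s * (3 * N + 2) = r + 2 * s + 3 * s * N by ring]
    ring

theorem progProd_one_mul_neg_one {r s : ℕ} (hs : 0 < s) :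
    progProd r s 1 * progProd r s (-1) = progProd (2 * r) (2 * s) (-1) := by
  rw [progProd, progProd, ← (multipliable_progProd hs 1).tprod_mul (multipliable_progProd hs (-1)),
    progProd]
  congr 1
  ext1 m
  simp only [map_neg, map_one]
  rw [show 2 * r + 2 * s * m = (r + s * m) * 2 by ring, pow_mul]
  ring

/-- Explicit truncation error: it reduces later statements about infinite products to finite
products modulo a power of q. -/
theorem X_pow_dvd_progProd_sub {r s : ℕ} (hr : 0 < r) (hs : 0 < s) (ε : ℤ) (N : ℕ) :
    X ^ (s * N + 1) ∣ progProd r s ε - ∏ m ∈ Finset.range N, (1 + C ε * X ^ (r + s * m)) := by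
  have key : ∀ k, X ^ (s * N + 1) ∣ ∏ m ∈ Finset.range (N + k), (1 + C ε * X ^ (r + s * m)) -
      (∏ m ∈ Finset.range N, (1 + C ε * X ^ (r + s * m)) : ℤ⟦X⟧) := by
    intro k
    induction k with
    | zero => simp
    | succ k ih =>
      rw [← add_assoc, Finset.prod_range_succ]
      set A := ∏ m ∈ Finset.range (N + k), (1 + C ε * X ^ (r + s * m) : ℤ⟦X⟧)
      have h : (X : ℤ⟦X⟧) ^ (s * N + 1) ∣ X ^ (r + s * (N + k)) := pow_dvd_pow _ (by nlinarith)
      have := ih.add (h.mul_left (A * C ε))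
      convert this using 1
      ring
  rw [X_pow_dvd_iff]
  intro d hd
  have h1 := ((PowerSeries.WithPiTopology.continuous_coeff ℤ d).tendsto _).comp
    (tendsto_progProd (r := r) hs ε)
  have h2 : Filter.Tendsto ((fun f : ℤ⟦X⟧ => coeff d f) ∘
      fun N => ∏ m ∈ Finset.range N, (1 + C ε * X ^ (r + s * m))) Filter.atTop
      (nhds (coeff d (∏ m ∈ Finset.range N, (1 + C ε * X ^ (r + s * m) : ℤ⟦X⟧)))) := by
    refine tendsto_const_nhds.congr' (Filter.eventually_atTop.mpr ⟨N, fun M hM => ?_⟩)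
    obtain ⟨k, rfl⟩ := Nat.exists_eq_add_of_le hM
    have := X_pow_dvd_iff.mp (key k) d hd
    rw [map_sub, sub_eq_zero] at this
    exact this.symm
  rw [map_sub, sub_eq_zero]
  exact tendsto_nhds_unique h1 h2

theorem constantCoeff_progProd {r s : ℕ} (hr : 0 < r) (hs : 0 < s) (ε : ℤ) :
    constantCoeff (progProd r s ε) = 1 := by
  have := X_pow_dvd_iff.mp (X_pow_dvd_progProd_sub hr hs ε 0) 0 (by simp)
  simpa [sub_eq_zero] using this

theorem progProd_ne_zero {r s : ℕ} (hr : 0 < r) (hs : 0 < s) (ε : ℤ) : progProd r s ε ≠ 0 := by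
  intro h
  simpa [h] using constantCoeff_progProd hr hs ε

theorem expand_progProd {k r s : ℕ} (hk : k ≠ 0) (hr : 0 < r) (hs : 0 < s) (ε : ℤ) :
    expand k hk (progProd r s ε) = progProd (k * r) (k * s) ε := by
  have hk' : 0 < k := Nat.pos_of_ne_zero hk
  ext d
  obtain ⟨u, hu⟩ := X_pow_dvd_progProd_sub hr hs ε (d + 1)
  have hv := X_pow_dvd_progProd_sub (Nat.mul_pos hk' hr) (Nat.mul_pos hk' hs) ε (d + 1)
  have h1 : (X : ℤ⟦X⟧) ^ (d + 1) ∣ expand k hk (progProd r s ε) -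
      ∏ m ∈ Finset.range (d + 1), (1 + C ε * X ^ (k * r + k * s * m)) := by
    have := congrArg (expand k hk) hu
    simp only [map_sub, map_prod, map_add, map_one, map_mul, map_pow, expand_C, expand_X] at this
    simp only [← pow_mul, mul_add, ← mul_assoc] at this ⊢
    rw [this]
    exact Dvd.dvd.mul_right (pow_dvd_pow _ (by nlinarith [Nat.mul_pos hk' hs])) _
  have h2 : (X : ℤ⟦X⟧) ^ (d + 1) ∣ progProd (k * r) (k * s) ε -
      ∏ m ∈ Finset.range (d + 1), (1 + C ε * X ^ (k * r + k * s * m)) :=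
    (pow_dvd_pow _ (by nlinarith [Nat.mul_pos hk' hs])).trans hv
  have h3 := X_pow_dvd_iff.mp (h1.sub h2) d (by omega)
  rwa [sub_sub_sub_cancel_right, map_sub, sub_eq_zero] at h3

theorem expand_qf {k m : ℕ} (hk : k ≠ 0) (hm : 0 < m) : expand k hk (qf m) = qf (k * m) := by
  rw [qf_eq_progProd, qf_eq_progProd, expand_progProd hk hm hm]

theorem qf_ne_zero {k : ℕ} (hk : 0 < k) : qf k ≠ 0 := by
  rw [qf_eq_progProd]
  exact progProd_ne_zero hk hk _

/-! ### Gaussian binomials and the Jacobi triple product -/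

/-- The finite Pochhammer product `∏_{m=1}^{i} (1 - q^{s m})`. -/
noncomputable def qPoch (s i : ℕ) : ℤ⟦X⟧ :=
  ∏ m ∈ Finset.range i, (1 + C (-1) * X ^ (s + s * m))

theorem qPoch_succ (s i : ℕ) : qPoch s (i + 1) = qPoch s i * (1 - X ^ (s * (i + 1))) := by
  rw [qPoch, Finset.prod_range_succ, ← qPoch, map_neg, map_one,
    show s + s * i = s * (i + 1) by ring]
  ring

theorem constantCoeff_qPoch {s : ℕ} (hs : 0 < s) (i : ℕ) : constantCoeff (qPoch s i) = 1 := by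
  rw [qPoch, map_prod]
  exact Finset.prod_eq_one fun m _ => by simp [hs.ne']

/-- The reciprocal of `qPoch s i`, extended by zero to negative integers `i`. -/
noncomputable def qPochInv (s : ℕ) (i : ℤ) : ℤ⟦X⟧ :=
  if 0 ≤ i then invOfUnit (qPoch s i.toNat) 1 else 0

theorem qPoch_mul_qPochInv {s : ℕ} (hs : 0 < s) (i : ℕ) : qPoch s i * qPochInv s i = 1 := by
  rw [qPochInv, if_pos (Int.natCast_nonneg i), Int.toNat_natCast, mul_invOfUnit]
  simp [constantCoeff_qPoch hs]

theorem qPochInv_of_neg (s : ℕ) {i : ℤ} (hi : i < 0) : qPochInv s i = 0 :=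
  if_neg (not_le.mpr hi)

theorem qPochInv_eq_mul_succ {s : ℕ} (hs : 0 < s) (i : ℕ) :
    qPochInv s i = (1 - X ^ (s * (i + 1))) * qPochInv s (i + 1 : ℕ) := by
  have h1 := qPoch_mul_qPochInv hs i
  have h2 := qPoch_mul_qPochInv hs (i + 1)
  rw [qPoch_succ] at h2
  calc qPochInv s i = qPochInv s i * (qPoch s i * (1 - X ^ (s * (i + 1))) *
        qPochInv s (i + 1 : ℕ)) := by rw [h2, mul_one]
    _ = (qPoch s i * qPochInv s i) * ((1 - X ^ (s * (i + 1))) * qPochInv s (i + 1 : ℕ)) := by ring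
    _ = _ := by rw [h1, one_mul]

/-- The central Gaussian binomial coefficient `[2N; N + n]` in base `q^s`. -/
noncomputable def centralGauss (s N : ℕ) (n : ℤ) : ℤ⟦X⟧ :=
  qPoch s (2 * N) * qPochInv s (N + n) * qPochInv s (N - n)

theorem centralGauss_eq_zero (s : ℕ) {N : ℕ} {n : ℤ} (h : N < n.natAbs) :
    centralGauss s N n = 0 := by
  rw [centralGauss]
  rcases lt_or_ge n 0 with hn | hn
  · rw [qPochInv_of_neg s (i := N + n) (by omega)]; ring
  · rw [qPochInv_of_neg s (i := N - n) (by omega)]; ring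

/-- Two q-Pascal steps at once, which keeps the coefficient central; its three terms are those
produced by the two new factors of the finite triple product. -/
theorem centralGauss_succ {s : ℕ} (hs : 0 < s) (N : ℕ) (n : ℤ) :
    centralGauss s (N + 1) n = (1 + X ^ (s * (2 * N + 1))) * centralGauss s N n +
      X ^ (s * (N - (n - 1)).toNat) * centralGauss s N (n - 1) +
      X ^ (s * (N + (n + 1)).toNat) * centralGauss s N (n + 1) := by
  have hu : qPoch s (2 * (N + 1)) =
      qPoch s (2 * N) * (1 - X ^ (s * (2 * N + 1))) * (1 - X ^ (s * (2 * N + 1 + 1))) := by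
    rw [show 2 * (N + 1) = 2 * N + 1 + 1 by ring, qPoch_succ, qPoch_succ]
  by_cases hout : N + 1 < n.natAbs
  · rw [centralGauss_eq_zero s hout, centralGauss_eq_zero s (by omega : N < n.natAbs),
      centralGauss_eq_zero s (by omega : N < (n - 1).natAbs),
      centralGauss_eq_zero s (by omega : N < (n + 1).natAbs)]
    ring
  obtain ⟨i, hi⟩ : ∃ i : ℕ, (N : ℤ) + 1 + n = i := ⟨(N + 1 + n).toNat, by omega⟩
  obtain ⟨j, hj⟩ : ∃ j : ℕ, (N : ℤ) + 1 - n = j := ⟨(N + 1 - n).toNat, by omega⟩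
  have e1 : ((N : ℤ) - (n - 1)).toNat = j := by omega
  have e2 : ((N : ℤ) + (n + 1)).toNat = i := by omega
  simp only [centralGauss, e1, e2, hu, Nat.cast_add, Nat.cast_one, hi, hj]
  rw [show (N : ℤ) + n = i - 1 by omega, show (N : ℤ) - n = j - 1 by omega,
    show (N : ℤ) + (n - 1) = i - 2 by omega, show (N : ℤ) - (n - 1) = j by omega,
    show (N : ℤ) + (n + 1) = i by omega, show (N : ℤ) - (n + 1) = j - 2 by omega]
  have hij : i + j = 2 * N + 2 := by omega
  -- one and two steps down, with the boundary conventions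
  have down1 : ∀ i : ℕ, qPochInv s ((i : ℤ) - 1) = (1 - X ^ (s * i)) * qPochInv s i := by
    intro i
    cases i with
    | zero => rw [qPochInv_of_neg s (by omega)]; simp
    | succ i => simpa using qPochInv_eq_mul_succ hs i
  have down2 : ∀ i : ℕ, X ^ s * qPochInv s ((i : ℤ) - 2) =
      (X ^ s - X ^ (s * i)) * (1 - X ^ (s * i)) * qPochInv s i := by
    intro i
    cases i with
    | zero => rw [qPochInv_of_neg s (by omega)]; simp
    | succ i =>
      have h := down1 i
      rw [qPochInv_eq_mul_succ hs i] at h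
      rw [show ((i + 1 : ℕ) : ℤ) - 2 = i - 1 by push_cast; ring, h]
      ring
  -- The factor q^s clears the exponents s(i-1), s(j-1) and s(i+j-1), so no truncated subtraction
  -- occurs.
  have hX : (X : ℤ⟦X⟧) ^ s ≠ 0 := pow_ne_zero _ X_ne_zero
  apply mul_left_cancel₀ hX
  have d1 := down2 i
  have d2 := down2 j
  rw [down1 i, down1 j]
  have e3 : (X : ℤ⟦X⟧) ^ s * X ^ (s * (2 * N + 1)) = X ^ (s * i) * X ^ (s * j) := by
    rw [← pow_add, ← pow_add]
    congr 1
    rw [← mul_add, hij]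
    ring
  have e4 : (X : ℤ⟦X⟧) ^ (s * (2 * N + 1 + 1)) = X ^ (s * i) * X ^ (s * j) := by
    rw [← pow_add, ← mul_add, hij]
  rw [e4]
  linear_combination (-qPoch s (2 * N) * X ^ (s * j) * qPochInv s j) * d1 -
    qPoch s (2 * N) * X ^ (s * i) * qPochInv s i * d2 -
    (qPoch s (2 * N) * qPochInv s i * qPochInv s j * ((1 - X ^ (s * i) * X ^ (s * j)) +
      (1 - X ^ (s * i)) * (1 - X ^ (s * j)))) * e3

theorem pow_natAbs_succ {ε : ℤ} (hε : ε * ε = 1) (n : ℤ) :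
    ε ^ (n + 1).natAbs = ε * ε ^ n.natAbs := by
  rcases lt_or_ge n 0 with hn | hn
  · rw [show n.natAbs = (n + 1).natAbs + 1 by omega, pow_succ]
    linear_combination -ε ^ (n + 1).natAbs * hε
  · rw [show (n + 1).natAbs = n.natAbs + 1 by omega, pow_succ]
    ring

section JacobiTriple

variable {a b : ℕ} {ε : ℤ} {e : ℤ → ℕ}

/-- Induction on N: in the product of the two new factors the cross terms shift the summation index
by ±1, and the result is regrouped by `centralGauss_succ`. -/
theorem hasSum_finite_jacobi (hs : 0 < a + b) (hε : ε * ε = 1)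
    (he : ∀ n : ℤ, 2 * (e n : ℤ) = a * (n * (n + 1)) + b * (n * (n - 1))) (N : ℕ) :
    HasSum (fun n : ℤ => centralGauss (a + b) N n * (C (ε ^ n.natAbs) * X ^ e n))
      (∏ m ∈ Finset.range N, ((1 + C ε * X ^ (a + (a + b) * m)) *
        (1 + C ε * X ^ (b + (a + b) * m)))) := by
  induction N with
  | zero =>
    convert hasSum_single (0 : ℤ) ?_ using 1
    · have h0 := he 0
      have h0' : e 0 = 0 := by simpa using h0
      have := qPoch_mul_qPochInv hs 0
      have h1 : qPoch (a + b) 0 = 1 := by simp [qPoch]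
      rw [h1, one_mul] at this
      simp only [Nat.cast_zero] at this
      simp [centralGauss, h0', h1, this]
    · intro n hn
      rw [centralGauss_eq_zero _ (by omega), zero_mul]
  | succ N ih =>
    rw [Finset.prod_range_succ]
    set F := ∏ m ∈ Finset.range N, ((1 + C ε * X ^ (a + (a + b) * m)) *
        (1 + C ε * X ^ (b + (a + b) * m)) : ℤ⟦X⟧)
    have hA := (Equiv.addRight (-1 : ℤ)).hasSum_iff.mpr
      (ih.mul_left (C ε * X ^ (a + (a + b) * N)))
    have hB := (Equiv.addRight (1 : ℤ)).hasSum_iff.mpr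
      (ih.mul_left (C ε * X ^ (b + (a + b) * N)))
    have h0 := ih.mul_left (1 + X ^ ((a + b) * (2 * N + 1)))
    have hCε : (C ε * C ε : ℤ⟦X⟧) = 1 := by rw [← map_mul, hε, map_one]
    have hval : F * ((1 + C ε * X ^ (a + (a + b) * N)) * (1 + C ε * X ^ (b + (a + b) * N))) =
        (1 + X ^ ((a + b) * (2 * N + 1))) * F + C ε * X ^ (a + (a + b) * N) * F +
          C ε * X ^ (b + (a + b) * N) * F := by
      have : (X : ℤ⟦X⟧) ^ ((a + b) * (2 * N + 1)) =
          X ^ (a + (a + b) * N) * X ^ (b + (a + b) * N) := by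
        rw [← pow_add]; congr 1; ring
      rw [this]
      linear_combination F * X ^ (a + (a + b) * N) * X ^ (b + (a + b) * N) * hCε
    rw [hval]
    refine (congrArg (HasSum · _) (funext fun n => ?_)).mpr ((h0.add hA).add hB)
    · simp only [Function.comp, Equiv.coe_addRight, ← sub_eq_add_neg]
      rw [centralGauss_succ hs]
      have shiftA : C ε * X ^ (a + (a + b) * N) * (centralGauss (a + b) N (n - 1) *
          (C (ε ^ (n - 1).natAbs) * X ^ e (n - 1))) =
          X ^ ((a + b) * (N - (n - 1)).toNat) * centralGauss (a + b) N (n - 1) *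
            (C (ε ^ n.natAbs) * X ^ e n) := by
        by_cases h : N < (n - 1).natAbs
        · rw [centralGauss_eq_zero _ h]; ring
        have hp := pow_natAbs_succ hε (n - 1)
        rw [sub_add_cancel] at hp
        rw [hp, map_mul]
        have hexp : a + (a + b) * N + e (n - 1) = (a + b) * (N - (n - 1)).toNat + e n := by
          zify
          rw [Int.toNat_of_nonneg (by omega)]
          have h1 := he n
          have h2 := he (n - 1)
          refine mul_left_cancel₀ (two_ne_zero (α := ℤ)) ?_
          linear_combination h2 - h1
        calc _ = centralGauss (a + b) N (n - 1) * (C ε * C (ε ^ (n - 1).natAbs)) *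
              (X ^ (a + (a + b) * N + e (n - 1))) := by rw [pow_add X (a + (a + b) * N)]; ring
          _ = _ := by rw [hexp, pow_add]; ring
      have shiftB : C ε * X ^ (b + (a + b) * N) * (centralGauss (a + b) N (n + 1) *
          (C (ε ^ (n + 1).natAbs) * X ^ e (n + 1))) =
          X ^ ((a + b) * (N + (n + 1)).toNat) * centralGauss (a + b) N (n + 1) *
            (C (ε ^ n.natAbs) * X ^ e n) := by
        by_cases h : N < (n + 1).natAbs
        · rw [centralGauss_eq_zero _ h]; ring
        rw [pow_natAbs_succ hε n, map_mul]
        have hexp : b + (a + b) * N + e (n + 1) = (a + b) * (N + (n + 1)).toNat + e n := by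
          zify
          rw [Int.toNat_of_nonneg (by omega)]
          have h1 := he n
          have h2 := he (n + 1)
          refine mul_left_cancel₀ (two_ne_zero (α := ℤ)) ?_
          linear_combination h2 - h1
        calc _ = (C ε * C ε) * (centralGauss (a + b) N (n + 1) * C (ε ^ n.natAbs)) *
              (X ^ (b + (a + b) * N + e (n + 1))) := by rw [pow_add X (b + (a + b) * N)]; ring
          _ = _ := by rw [hexp, pow_add, hCε]; ring
      rw [shiftA, shiftB]
      ring

theorem X_pow_dvd_centralGauss_sub_one {s : ℕ} (hs : 0 < s) {N : ℕ} {n : ℤ} (hn : n.natAbs ≤ N) :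
    X ^ (N - n.natAbs + 1) ∣ progProd s s (-1) * centralGauss s N n - 1 := by
  obtain ⟨i, hi⟩ : ∃ i : ℕ, (N : ℤ) + n = i := ⟨(N + n).toNat, by omega⟩
  obtain ⟨j, hj⟩ : ∃ j : ℕ, (N : ℤ) - n = j := ⟨(N - n).toNat, by omega⟩
  have key : ∀ i : ℕ, N - n.natAbs ≤ i →
      (X : ℤ⟦X⟧) ^ (N - n.natAbs + 1) ∣ progProd s s (-1) - qPoch s i := fun i hi =>
    (pow_dvd_pow _ (by nlinarith)).trans (X_pow_dvd_progProd_sub hs hs (-1) i)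
  have h1 := key i (by omega)
  have h2 := key j (by omega)
  have h3 := key (2 * N) (by omega)
  have hu1 := qPoch_mul_qPochInv hs i
  have hu2 := qPoch_mul_qPochInv hs j
  rw [centralGauss, hi, hj]
  set E := progProd s s (-1)
  have := ((h1.mul_right (qPochInv s i)).add
    (h2.mul_right (E * qPochInv s i * qPochInv s j))).sub
    (h3.mul_right (E * qPochInv s i * qPochInv s j))
  convert this using 1
  linear_combination hu1 + E * qPochInv s i * hu2

/-- The Jacobi triple product identity with `A = ε q^a` and `B = ε q^b`:
`∑ A^{n(n+1)/2} B^{n(n-1)/2}` is `∏ (1 - (AB)^{m+1}) (1 + A (AB)^m) (1 + B (AB)^m)`. -/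
theorem hasSum_jacobi_triple (ha : 0 < a) (hb : 0 < b) (hε : ε * ε = 1)
    (he : ∀ n : ℤ, 2 * (e n : ℤ) = a * (n * (n + 1)) + b * (n * (n - 1))) :
    HasSum (fun n : ℤ => (C (ε ^ n.natAbs) * X ^ e n : ℤ⟦X⟧))
      (progProd (a + b) (a + b) (-1) * (progProd a (a + b) ε * progProd b (a + b) ε)) := by
  have hs : 0 < a + b := by omega
  rw [PowerSeries.WithPiTopology.hasSum_iff_hasSum_coeff]
  intro K
  -- The finite identity of level K already determines the coefficient of q^K.
  have hfin := ((PowerSeries.WithPiTopology.hasSum_iff_hasSum_coeff _).mp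
    ((hasSum_finite_jacobi hs hε he K).mul_left (progProd (a + b) (a + b) (-1)))) K
  convert hfin using 1
  · ext1 n
    -- The normalised Gaussian coefficient is 1 only modulo q^(K-|n|+1); the missing |n| powers come
    -- from q^(e n).
    have hen : n.natAbs ≤ e n := by
      have h := he n
      have ha' : (1 : ℤ) ≤ a := by exact_mod_cast ha
      have hb' : (1 : ℤ) ≤ b := by exact_mod_cast hb
      rcases lt_or_ge n 0 with hn | hn
      · zify; rw [abs_of_neg hn]
        nlinarith [mul_nonneg (sub_nonneg.mpr ha') (by nlinarith : 0 ≤ n * (n + 1)),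
          mul_nonneg (sub_nonneg.mpr hb') (by nlinarith : 0 ≤ n * (n - 1))]
      · zify; rw [abs_of_nonneg hn]
        have : 0 ≤ n * (n - 1) := by
          rcases hn.eq_or_lt with h | h
          · simp [← h]
          · exact mul_nonneg hn (by omega)
        nlinarith [mul_nonneg (sub_nonneg.mpr ha') (by nlinarith : 0 ≤ n * (n + 1)),
          mul_nonneg (sub_nonneg.mpr hb') this]
    have hdvd : (X : ℤ⟦X⟧) ^ (K + 1) ∣ progProd (a + b) (a + b) (-1) *
        (centralGauss (a + b) K n * (C (ε ^ n.natAbs) * X ^ e n)) -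
          C (ε ^ n.natAbs) * X ^ e n := by
      by_cases hn : n.natAbs ≤ K
      · have := (mul_dvd_mul (X_pow_dvd_centralGauss_sub_one hs hn)
          (pow_dvd_pow (X : ℤ⟦X⟧) hen)).mul_right (C (ε ^ n.natAbs))
        rw [← pow_add, show K - n.natAbs + 1 + n.natAbs = K + 1 by omega] at this
        convert this using 1
        ring
      · rw [centralGauss_eq_zero _ (by omega), zero_mul, mul_zero, zero_sub, dvd_neg]
        exact (pow_dvd_pow _ (by omega)).mul_left _
    have := X_pow_dvd_iff.mp hdvd K (by omega)
    rw [map_sub, sub_eq_zero] at this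
    exact this.symm
  · have hd : ∀ r, 0 < r → (X : ℤ⟦X⟧) ^ (K + 1) ∣ progProd r (a + b) ε -
        ∏ m ∈ Finset.range K, (1 + C ε * X ^ (r + (a + b) * m)) := fun r hr =>
      (pow_dvd_pow _ (by nlinarith)).trans (X_pow_dvd_progProd_sub hr hs ε K)
    have h1 := hd a ha
    have h2 := hd b hb
    rw [Finset.prod_mul_distrib]
    set A := progProd a (a + b) ε
    set B := progProd b (a + b) ε
    set PA := ∏ m ∈ Finset.range K, (1 + C ε * X ^ (a + (a + b) * m) : ℤ⟦X⟧)
    set PB := ∏ m ∈ Finset.range K, (1 + C ε * X ^ (b + (a + b) * m) : ℤ⟦X⟧)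
    have h3 := ((h1.mul_right B).add (h2.mul_left PA)).mul_left (progProd (a + b) (a + b) (-1))
    rw [show (A - PA) * B + PA * (B - PB) = A * B - PA * PB by ring, mul_sub] at h3
    have := X_pow_dvd_iff.mp h3 K (by omega)
    rwa [map_sub, sub_eq_zero] at this

end JacobiTriple

/-! ### Theta functions and their 3-dissections -/

theorem hasSum_of_partition {ι κ M : Type*} [Fintype ι] [DecidableEq ι] [AddCommMonoid M]
    [TopologicalSpace M] [ContinuousAdd M] {f : κ → M} {g : ι → κ → κ} {a : ι → M} (c : κ → ι)
    (hg : ∀ i, Function.Injective (g i)) (hc : ∀ i n, c (g i n) = i)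
    (hsurj : ∀ n, ∃ m, g (c n) m = n) (h : ∀ i, HasSum (fun n => f (g i n)) (a i)) :
    HasSum f (∑ i, a i) := by
  have h1 : ∀ i ∈ Finset.univ, HasSum (fun n => if c n = i then f n else 0) (a i) := by
    intro i _
    refine ((hg i).hasSum_iff ?_).mp ?_
    · intro n hn
      refine if_neg fun hci => hn ?_
      obtain ⟨m, hm⟩ := hsurj n
      exact ⟨m, hci ▸ hm⟩
    · simpa [Function.comp_def, hc] using h i
  simpa using hasSum_sum h1

/-- The theta function `∑ (ε q^a)^{n(n+1)/2} (ε q^b)^{n(n-1)/2}`, in product form. -/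
noncomputable def thetaProd (a b : ℕ) (ε : ℤ) : ℤ⟦X⟧ :=
  progProd (a + b) (a + b) (-1) * (progProd a (a + b) ε * progProd b (a + b) ε)

theorem expand_thetaProd {k a b : ℕ} (hk : k ≠ 0) (ha : 0 < a) (hb : 0 < b) (ε : ℤ) :
    expand k hk (thetaProd a b ε) = thetaProd (k * a) (k * b) ε := by
  have hs : 0 < a + b := by omega
  simp only [thetaProd, map_mul, expand_progProd hk hs hs, expand_progProd hk ha hs,
    expand_progProd hk hb hs, mul_add]

theorem thetaProd_phi_mul_psi : thetaProd 1 1 (-1) * thetaProd 1 3 1 = qf 1 * qf 2 := by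
  simp only [thetaProd, qf_eq_progProd, Nat.reduceAdd]
  have h1 := progProd_two_split (r := 1) (s := 1) one_pos (-1)
  have h2 := progProd_two_split (r := 1) (s := 2) two_pos 1
  have h3 := progProd_one_mul_neg_one (r := 1) (s := 2) two_pos
  have h4 := progProd_two_split (r := 2) (s := 2) two_pos (-1)
  norm_num only at h1 h2 h3 h4
  rw [h1, h4, ← h3, h2]
  ring

/-- An Euler-type cancellation: (-q;q^3)(-q^2;q^3) is the reciprocal of (q;q^6)(q^5;q^6), checked
after multiplying by (q;q^3)(q^2;q^3). -/
theorem thetaProd_mul_cubic : thetaProd 5 1 (-1) * thetaProd 2 1 1 = qf 3 * qf 6 := by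
  simp only [thetaProd, qf_eq_progProd, Nat.reduceAdd]
  have h1 := progProd_two_split (r := 1) (s := 3) three_pos (-1)
  have h2 := progProd_two_split (r := 2) (s := 3) three_pos (-1)
  have h3 := progProd_one_mul_neg_one (r := 1) (s := 3) three_pos
  have h4 := progProd_one_mul_neg_one (r := 2) (s := 3) three_pos
  norm_num only at h1 h2 h3 h4
  have n1 := progProd_ne_zero (r := 1) one_pos three_pos (-1)
  have n2 := progProd_ne_zero (r := 2) two_pos three_pos (-1)
  have key : progProd 5 6 (-1) * progProd 1 6 (-1) * (progProd 2 3 1 * progProd 1 3 1) = 1 := by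
    apply mul_right_cancel₀ (mul_ne_zero n1 n2)
    calc _ = progProd 5 6 (-1) * progProd 1 6 (-1) * (progProd 2 3 1 * progProd 2 3 (-1)) *
          (progProd 1 3 1 * progProd 1 3 (-1)) := by ring
      _ = _ := by rw [h3, h4, h1, h2]; ring
  linear_combination progProd 6 6 (-1) * progProd 3 3 (-1) * key

theorem neg_one_pow_natAbs_eq (n : ℤ) : (-1 : ℤ) ^ n.natAbs = if Even n then 1 else -1 := by
  split_ifs with h
  · exact (Int.natAbs_even.mpr h).neg_one_pow
  · exact (Int.natAbs_odd.mpr (Int.not_even_iff_odd.mp h)).neg_one_pow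

/-- Split the sum of (-1)^n q^(n^2) by n modulo 3; the classes 1 and 2 are exchanged by n ↦ -n and
contribute equally, whence the factor 2. -/
theorem thetaProd_phi_dissection :
    thetaProd 1 1 (-1) = thetaProd 9 9 (-1) - 2 * X * thetaProd 15 3 (-1) := by
  have hφ := hasSum_jacobi_triple (a := 1) (b := 1) (ε := -1) (e := fun n => (n * n).toNat)
    (by norm_num) (by norm_num) (by norm_num)
    (fun n => by rw [Int.toNat_of_nonneg (mul_self_nonneg n)]; push_cast; ring)
  have hφ9 := hasSum_jacobi_triple (a := 9) (b := 9) (ε := -1) (e := fun n => (9 * n * n).toNat)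
    (by norm_num) (by norm_num) (by norm_num)
    (fun n => by rw [Int.toNat_of_nonneg (by nlinarith [mul_self_nonneg n])]; push_cast; ring)
  have hnn : ∀ n : ℤ, 0 ≤ 9 * n * n + 6 * n := fun n => by
    rcases lt_or_ge n 0 with h | h <;> nlinarith
  have hP := (hasSum_jacobi_triple (a := 15) (b := 3) (ε := -1)
    (e := fun n => (9 * n * n + 6 * n).toNat)
    (by norm_num) (by norm_num) (by norm_num)
    (fun n => by rw [Int.toNat_of_nonneg (hnn n)]; push_cast; ring)).mul_left (-X)
  have h3 := hasSum_of_partition (ι := Fin 3) (κ := ℤ)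
    (f := fun n : ℤ => (C ((-1) ^ n.natAbs) * X ^ (n * n).toNat : ℤ⟦X⟧))
    (g := ![fun n => 3 * n, fun n => 3 * n + 1, fun n => -(3 * n + 1)])
    (a := ![thetaProd 9 9 (-1), -X * thetaProd 15 3 (-1), -X * thetaProd 15 3 (-1)])
    (fun n => if n % 3 = 0 then 0 else if n % 3 = 1 then 1 else 2)
    (by
      intro i m n h
      fin_cases i <;> simp at h <;> omega)
    (by
      intro i n
      fin_cases i <;> simp)
    (by
      intro n
      by_cases h0 : n % 3 = 0
      · exact ⟨n / 3, by simp [h0]; omega⟩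
      by_cases h1 : n % 3 = 1
      · exact ⟨n / 3, by simp [h1]; omega⟩
      · exact ⟨(-n) / 3, by simp [h0, h1]; omega⟩)
    (by
      have hsgn : ∀ n : ℤ, (-1 : ℤ) ^ (3 * n + 1).natAbs = -(-1) ^ n.natAbs := by
        intro n
        simp only [neg_one_pow_natAbs_eq, Int.even_iff]
        split_ifs <;> omega
      have hexp : ∀ n : ℤ, ((3 * n + 1) * (3 * n + 1)).toNat =
          1 + (9 * n * n + 6 * n).toNat := by
        intro n
        rw [show (3 * n + 1) * (3 * n + 1) = 1 + (9 * n * n + 6 * n) by ring,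
          Int.toNat_add (by norm_num) (hnn n)]
        rfl
      intro i
      fin_cases i
      · refine (congrArg (HasSum · _) (funext fun n => ?_)).mpr hφ9
        have : (-1 : ℤ) ^ (3 * n).natAbs = (-1) ^ n.natAbs := by
          simp only [neg_one_pow_natAbs_eq, Int.even_iff]
          split_ifs <;> omega
        simp only [Fin.zero_eta, Matrix.cons_val_zero, this]
        rw [show 3 * n * (3 * n) = 9 * n * n by ring]
      · refine (congrArg (HasSum · _) (funext fun n => ?_)).mpr hP
        simp only [Fin.mk_one, Matrix.cons_val_one, Matrix.cons_val_zero, hsgn, hexp, pow_add,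
          pow_one, map_neg]
        ring
      · refine (congrArg (HasSum · _) (funext fun n => ?_)).mpr hP
        simp only [Fin.reduceFinMk, Matrix.cons_val, Int.natAbs_neg, neg_mul_neg, hsgn, hexp,
          pow_add, pow_one, map_neg]
        ring)
  have := hφ.unique h3
  rw [thetaProd, this]
  simp only [Fin.sum_univ_three, Matrix.cons_val]
  ring

theorem thetaProd_psi_dissection :
    thetaProd 1 3 1 = thetaProd 6 3 1 + X * thetaProd 9 27 1 := by
  have hnn1 : ∀ n : ℤ, 0 ≤ n * (2 * n - 1) := fun n => by
    rcases le_or_gt n 0 with h | h <;> nlinarith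
  have hnn2 : ∀ n : ℤ, 0 ≤ n * (3 * n + 1) := fun n => by
    rcases lt_or_ge n 0 with h | h <;> nlinarith
  have heven : ∀ n : ℤ, 2 * (n * (3 * n + 1) / 2) = n * (3 * n + 1) := fun n => by
    refine Int.mul_ediv_cancel' (Int.dvd_of_emod_eq_zero ?_)
    rcases Int.emod_two_eq_zero_or_one n with h | h <;> simp [Int.mul_emod, Int.add_emod, h]
  have hψ := hasSum_jacobi_triple (a := 1) (b := 3) (ε := 1)
    (e := fun n => (n * (2 * n - 1)).toNat)
    (by norm_num) (by norm_num) (by norm_num)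
    (fun n => by rw [Int.toNat_of_nonneg (hnn1 n)]; push_cast; ring)
  have hψ9 := ((hasSum_jacobi_triple (a := 9) (b := 27) (ε := 1)
    (e := fun n => (9 * (n * (2 * n - 1))).toNat)
    (by norm_num) (by norm_num) (by norm_num)
    (fun n => by
      rw [Int.toNat_of_nonneg (by nlinarith [hnn1 n])]; push_cast; ring)).mul_left X)
  -- At 3n+1 the exponent is 1 + 9n(2n+1), so the index must be negated to match n(2n-1).
  have hψ9' := (Equiv.neg ℤ).hasSum_iff.mpr hψ9
  have hR := hasSum_jacobi_triple (a := 6) (b := 3) (ε := 1)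
    (e := fun n => (3 * (n * (3 * n + 1) / 2)).toNat)
    (by norm_num) (by norm_num) (by norm_num)
    (fun n => by
      have h := heven n
      rw [Int.toNat_of_nonneg (by have := hnn2 n; omega)]
      push_cast
      linear_combination 3 * h)
  have h2 := hasSum_of_partition (ι := Fin 2) (κ := ℤ)
    (f := fun n : ℤ => (C (1 ^ n.natAbs) * X ^ (n * (2 * n - 1)).toNat : ℤ⟦X⟧))
    -- The residues 0 and 2 modulo 3 interleave into one theta series: k = -2m goes to 3m and k =
    -- -(2m+1) to -(3m+1), and n(2n-1) becomes 3k(3k+1)/2.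
    (g := ![fun k => if k % 2 = 0 then 3 * (-k / 2) else -(3 * ((-k - 1) / 2) + 1),
      fun n => 3 * n + 1])
    (a := ![thetaProd 6 3 1, X * thetaProd 9 27 1])
    (fun n => if n % 3 = 1 then 1 else 0)
    (by
      intro i m n h
      fin_cases i
      · simp at h; split_ifs at h <;> omega
      · simp at h; omega)
    (by
      intro i n
      fin_cases i
      · simp; split_ifs <;> omega
      · simp)
    (by
      intro n
      by_cases h1 : n % 3 = 1
      · exact ⟨n / 3, by simp [h1]; omega⟩
      · by_cases h0 : n % 3 = 0
        · refine ⟨-2 * (n / 3), ?_⟩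
          simp [h0]; omega
        · refine ⟨-(2 * ((-n - 1) / 3) + 1), ?_⟩
          simp [h1]; split_ifs <;> omega)
    (by
      intro i
      fin_cases i
      · refine (congrArg (HasSum · _) (funext fun k => ?_)).mpr hR
        simp only [Fin.zero_eta, Matrix.cons_val_zero, one_pow]
        congr 3
        have hk := heven k
        split_ifs with h
        · obtain ⟨m, rfl⟩ : ∃ m, k = -2 * m := ⟨-k / 2, by omega⟩
          rw [show -(-2 * m) / 2 = m by omega]
          refine mul_left_cancel₀ (two_ne_zero (α := ℤ)) ?_
          linear_combination -3 * hk
        · obtain ⟨m, rfl⟩ : ∃ m, k = -(2 * m + 1) := ⟨(-k - 1) / 2, by omega⟩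
          rw [show (-(-(2 * m + 1)) - 1) / 2 = m by omega]
          refine mul_left_cancel₀ (two_ne_zero (α := ℤ)) ?_
          linear_combination -3 * hk
      · refine (congrArg (HasSum · _) (funext fun n => ?_)).mpr hψ9'
        simp only [Fin.mk_one, Matrix.cons_val_one, Matrix.cons_val_zero, one_pow,
          Function.comp, Equiv.neg_apply, map_one, one_mul]
        rw [show (3 * n + 1) * (2 * (3 * n + 1) - 1) = 1 + 9 * (-n * (2 * -n - 1)) by ring,
          Int.toNat_add (by norm_num) (by nlinarith [hnn1 (-n)]), pow_add]
        simp)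
  have := hψ.unique h2
  rw [thetaProd, this]
  simp only [Fin.sum_univ_two, Matrix.cons_val]

/-- The 3-dissection of `f_1 f_2`: the product of its outer components is `-2 (f_9 f_18)^2`. -/
theorem exists_qf_one_mul_qf_two_dissection :
    ∃ a c : ℤ⟦X⟧, a * c = -2 * (qf 3 * qf 6) ^ 2 ∧
      qf 1 * qf 2 = expand 3 three_ne_zero a - X * expand 3 three_ne_zero (qf 3 * qf 6) +
        X ^ 2 * expand 3 three_ne_zero c := by
  have hφψ : thetaProd 3 3 (-1) * thetaProd 3 9 1 = qf 3 * qf 6 := by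
    have := congrArg (expand 3 three_ne_zero) thetaProd_phi_mul_psi
    simpa [expand_thetaProd, expand_qf] using this
  have hφψ9 : thetaProd 9 9 (-1) * thetaProd 9 27 1 = expand 3 three_ne_zero (qf 3 * qf 6) := by
    rw [← hφψ]
    simp [expand_thetaProd]
  have hPR := thetaProd_mul_cubic
  have hPR3 : thetaProd 15 3 (-1) * thetaProd 6 3 1 = expand 3 three_ne_zero (qf 3 * qf 6) := by
    rw [← hPR]
    simp [expand_thetaProd]
  -- The outer components of the product of the two dissections. The middle one is f_9 f_18 - 2 f_9
  -- f_18, both cross products being equal to f_9 f_18 up to that factor.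
  refine ⟨thetaProd 3 3 (-1) * thetaProd 2 1 1, -2 * (thetaProd 5 1 (-1) * thetaProd 3 9 1),
    ?_, ?_⟩
  · linear_combination (-2 * thetaProd 5 1 (-1) * thetaProd 2 1 1) * hφψ -
      2 * (qf 3 * qf 6) * hPR
  · rw [← thetaProd_phi_mul_psi, thetaProd_phi_dissection, thetaProd_psi_dissection]
    simp only [map_mul, map_neg, map_ofNat, expand_thetaProd three_ne_zero three_pos three_pos,
      expand_thetaProd three_ne_zero two_pos one_pos,
      expand_thetaProd three_ne_zero (show 0 < 5 by norm_num) one_pos,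
      expand_thetaProd three_ne_zero three_pos (show 0 < 9 by norm_num)] at hPR3 hφψ9 ⊢
    norm_num only
    linear_combination X * hφψ9 - 2 * X * hPR3

/-! ### The norm under q ↦ ωq -/

/-- The base change from integral to complex power series. -/
noncomputable def toComplexSeries : ℤ⟦X⟧ →+* ℂ⟦X⟧ := PowerSeries.map (Int.castRingHom ℂ)

theorem toComplexSeries_injective : Function.Injective toComplexSeries :=
  PowerSeries.map_injective _ Int.cast_injective

/-- The product of the conjugates of `f` under `q ↦ ω q`, `ω` a cube root of unity. -/
noncomputable def cubeNorm (ω : ℂ) (f : ℤ⟦X⟧) : ℂ⟦X⟧ :=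
  toComplexSeries f * rescale ω (toComplexSeries f) * rescale (ω ^ 2) (toComplexSeries f)

theorem cubeNorm_mul (ω : ℂ) (f g : ℤ⟦X⟧) :
    cubeNorm ω (f * g) = cubeNorm ω f * cubeNorm ω g := by
  simp only [cubeNorm, map_mul]
  ring

theorem cubeNorm_prod (ω : ℂ) {ι : Type*} (s : Finset ι) (f : ι → ℤ⟦X⟧) :
    cubeNorm ω (∏ i ∈ s, f i) = ∏ i ∈ s, cubeNorm ω (f i) := by
  simp only [cubeNorm, map_prod, Finset.prod_mul_distrib]

theorem X_pow_dvd_cubeNorm_sub (ω : ℂ) {f g : ℤ⟦X⟧} {n : ℕ} (h : X ^ n ∣ f - g) :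
    X ^ n ∣ cubeNorm ω f - cubeNorm ω g := by
  have h1 : ∀ z : ℂ, (X : ℂ⟦X⟧) ^ n ∣ rescale z (toComplexSeries f) -
      rescale z (toComplexSeries g) := by
    intro z
    obtain ⟨u, hu⟩ := h
    rw [← map_sub, ← map_sub, hu]
    simp only [map_mul, map_pow, toComplexSeries, PowerSeries.map_X, rescale_X, mul_pow]
    exact ⟨_, by rw [mul_comm (C z ^ n), mul_assoc]⟩
  have h0 := h1 1
  simp only [rescale_one, RingHom.id_apply] at h0
  have := ((h0.mul_right (rescale ω (toComplexSeries f) * rescale (ω ^ 2) (toComplexSeries f))).add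
    ((h1 ω).mul_left (toComplexSeries g * rescale (ω ^ 2) (toComplexSeries f)))).add
    ((h1 (ω ^ 2)).mul_left (toComplexSeries g * rescale ω (toComplexSeries g)))
  convert this using 1
  simp only [cubeNorm]
  ring

theorem rescale_expand_of_pow_eq_one {R : Type*} [CommRing R] {k : ℕ} (hk : k ≠ 0) {ω : R}
    (hω : ω ^ k = 1) (f : R⟦X⟧) : rescale ω (expand k hk f) = expand k hk f := by
  ext n
  rw [coeff_rescale, coeff_expand]
  split_ifs with h
  · obtain ⟨m, rfl⟩ := h
    rw [pow_mul, hω, one_pow, one_mul]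
  · rw [mul_zero]

section CubeRoot

variable {ω : ℂ} (hω : IsPrimitiveRoot ω 3)
include hω

theorem cubeNorm_expand (f : ℤ⟦X⟧) :
    cubeNorm ω (expand 3 three_ne_zero f) = toComplexSeries (expand 3 three_ne_zero f) ^ 3 := by
  have h3 : ω ^ 3 = 1 := hω.pow_eq_one
  have h3' : (ω ^ 2) ^ 3 = 1 := by rw [← pow_mul, mul_comm, pow_mul, h3, one_pow]
  simp only [cubeNorm, toComplexSeries, map_expand, rescale_expand_of_pow_eq_one _ h3,
    rescale_expand_of_pow_eq_one _ h3']
  ring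

theorem IsPrimitiveRoot.one_add_add_sq_eq_zero : 1 + ω + ω ^ 2 = 0 := by
  simpa [Finset.sum_range_succ] using hω.geom_sum_eq_zero (by norm_num)

/-- As n is prime to 3, ω^n is again primitive, and (1-x)(1-ζx)(1-ζ²x) = 1-x^3 for a primitive cube
root ζ. -/
theorem cubeNorm_one_sub_X_pow {n : ℕ} (hn : ¬ 3 ∣ n) :
    cubeNorm ω (1 + C (-1) * X ^ n) = toComplexSeries (1 + C (-1) * X ^ (3 * n)) := by
  have hζ : 1 + ω ^ n + (ω ^ n) ^ 2 = 0 :=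
    (hω.pow_of_coprime n ((Nat.prime_three.coprime_iff_not_dvd.mpr hn).symm)).one_add_add_sq_eq_zero
  have hC : (1 : ℂ⟦X⟧) + C (ω ^ n) + C (ω ^ n) ^ 2 = 0 := by
    rw [← map_one (C (R := ℂ)), ← map_pow, ← map_add, ← map_add, hζ, map_zero]
  have h2 : (ω ^ 2) ^ n = (ω ^ n) ^ 2 := by rw [← pow_mul, ← pow_mul, mul_comm]
  simp only [cubeNorm, toComplexSeries, map_add, map_mul, map_one, map_pow, map_neg,
    PowerSeries.map_X, rescale_X, mul_pow] at hC ⊢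
  rw [← pow_mul, mul_comm 2 n, pow_mul, mul_comm 3 n, pow_mul]
  set z := (C ω : ℂ⟦X⟧) ^ n
  set x := (X : ℂ⟦X⟧) ^ n
  linear_combination (x ^ 2 * z - x - (z - 1) * x ^ 3) * hC

theorem cubeNorm_progProd {r s : ℕ} (hr : ¬ 3 ∣ r) (hs : 0 < s) (hs3 : 3 ∣ s) :
    cubeNorm ω (progProd r s (-1)) = toComplexSeries (progProd (3 * r) (3 * s) (-1)) := by
  have hr0 : 0 < r := Nat.pos_of_ne_zero fun h => hr (h ▸ dvd_zero 3)
  ext d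
  have h1 := X_pow_dvd_cubeNorm_sub ω (X_pow_dvd_progProd_sub hr0 hs (-1) d)
  have h2 := map_dvd toComplexSeries
    (X_pow_dvd_progProd_sub (show 0 < 3 * r by omega) (show 0 < 3 * s by omega) (-1) d)
  rw [cubeNorm_prod] at h1
  rw [map_sub, map_prod, map_pow, toComplexSeries, PowerSeries.map_X, ← toComplexSeries] at h2
  have h3 : ∀ m, cubeNorm ω (1 + C (-1) * X ^ (r + s * m)) =
      toComplexSeries (1 + C (-1) * X ^ (3 * r + 3 * s * m)) := by
    intro m
    rw [cubeNorm_one_sub_X_pow hω, mul_add, mul_assoc]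
    rwa [Nat.dvd_add_left (hs3.mul_right m)]
  simp only [h3] at h1
  have h4 := ((pow_dvd_pow _ (by nlinarith : d + 1 ≤ s * d + 1)).trans h1).sub
    ((pow_dvd_pow _ (by nlinarith : d + 1 ≤ 3 * s * d + 1)).trans h2)
  rw [sub_sub_sub_cancel_right] at h4
  have := X_pow_dvd_iff.mp h4 d (by omega)
  rwa [map_sub, sub_eq_zero] at this

/-- Factors of f_k with index divisible by 3 form f_{3k} and are cubed; the others have q replaced
by q^3 and give f_{3k}/f_{9k}. -/
theorem cubeNorm_qf {k : ℕ} (hk : ¬ 3 ∣ k) :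
    cubeNorm ω (qf k) * toComplexSeries (qf (9 * k)) = toComplexSeries (qf (3 * k)) ^ 4 := by
  have hk0 : 0 < k := Nat.pos_of_ne_zero fun h => hk (h ▸ dvd_zero 3)
  have h1 : qf k = progProd k (3 * k) (-1) * progProd (2 * k) (3 * k) (-1) *
      expand 3 three_ne_zero (qf k) := by
    rw [expand_qf three_ne_zero hk0, qf_eq_progProd (3 * k), qf_eq_progProd,
      progProd_three_split hk0]
    congr 2 <;> congr 1 <;> ring
  have h2 : qf (3 * k) = progProd (3 * k) (9 * k) (-1) * progProd (6 * k) (9 * k) (-1) *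
      qf (9 * k) := by
    have h := progProd_three_split (r := 3 * k) (show 0 < 3 * k by omega) (-1)
    rw [show 3 * (3 * k) = 9 * k by ring, show 3 * k + 3 * k = 6 * k by ring,
      show 3 * k + 2 * (3 * k) = 9 * k by ring] at h
    rwa [qf_eq_progProd, qf_eq_progProd]
  have h3 : 0 < 3 * k := by omega
  conv_lhs => rw [h1]
  rw [cubeNorm_mul, cubeNorm_mul, cubeNorm_expand hω,
    cubeNorm_progProd hω hk h3 (dvd_mul_right 3 k),
    cubeNorm_progProd hω (by omega : ¬ 3 ∣ 2 * k) h3 (dvd_mul_right 3 k),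
    expand_qf three_ne_zero hk0]
  have h4 := congrArg toComplexSeries h2
  rw [map_mul, map_mul] at h4
  rw [show 3 * (3 * k) = 9 * k by ring, show 3 * (2 * k) = 6 * k by ring]
  linear_combination -toComplexSeries (qf (3 * k)) ^ 3 * h4

/-- This is x^3 + y^3 + z^3 - 3xyz = ∏ (x + ω^i y + ω^{2i} z) applied to the three components. -/
theorem cubeNorm_dissection (a b c : ℤ⟦X⟧) :
    cubeNorm ω (expand 3 three_ne_zero a - X * expand 3 three_ne_zero b +
        X ^ 2 * expand 3 three_ne_zero c) =
      toComplexSeries (expand 3 three_ne_zero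
        (a ^ 3 - X * b ^ 3 + X ^ 2 * c ^ 3 + 3 * X * a * b * c)) := by
  have h3 : ω ^ 3 = 1 := hω.pow_eq_one
  have h3' : (ω ^ 2) ^ 3 = 1 := by rw [← pow_mul, mul_comm, pow_mul, h3, one_pow]
  have hC : (1 : ℂ⟦X⟧) + C ω + C ω ^ 2 = 0 := by
    rw [← map_one (C (R := ℂ)), ← map_pow, ← map_add, ← map_add, hω.one_add_add_sq_eq_zero,
      map_zero]
  simp only [cubeNorm, toComplexSeries, map_add, map_sub, map_mul, map_pow, map_expand,
    map_ofNat, expand_X, PowerSeries.map_X, rescale_X, rescale_expand_of_pow_eq_one _ h3,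
    rescale_expand_of_pow_eq_one _ h3']
  set A := expand 3 three_ne_zero (PowerSeries.map (Int.castRingHom ℂ) a)
  set B := expand 3 three_ne_zero (PowerSeries.map (Int.castRingHom ℂ) b)
  set D := expand 3 three_ne_zero (PowerSeries.map (Int.castRingHom ℂ) c)
  set z := (C ω : ℂ⟦X⟧)
  have hz : z ^ 2 = -1 - z := by linear_combination hC
  have hz4 : z ^ 4 = z := by
    rw [show z ^ 4 = z ^ 2 * z ^ 2 by ring, hz]
    linear_combination hz
  have e1 : A - z * X * B + (z * X) ^ 2 * D = A - z * X * B + (-1 - z) * X ^ 2 * D := by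
    rw [mul_pow, hz]
  have e2 : A - z ^ 2 * X * B + (z ^ 2 * X) ^ 2 * D = A - (-1 - z) * X * B + z * X ^ 2 * D := by
    rw [mul_pow, ← pow_mul, hz4, hz]
  rw [e1, e2]
  linear_combination (-A * X ^ 2 * B ^ 2 - 2 * A * X ^ 3 * B * D - A * X ^ 4 * D ^ 2 +
    X ^ 3 * B ^ 3 + X ^ 4 * B ^ 2 * D - X ^ 5 * B * D ^ 2 - X ^ 6 * D ^ 3) * hC

end CubeRoot

/-! ### Sections modulo 3 -/

/-- The substitution `q ↦ q^3`. -/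
noncomputable def cubeSubst : ℤ⟦X⟧ →ₐ[ℤ] ℤ⟦X⟧ := expand 3 three_ne_zero

/-- The series `∑ c(3n + r) q^n` extracted from `∑ c(n) q^n`. -/
noncomputable def triSection (r : ℕ) : ℤ⟦X⟧ →ₗ[ℤ] ℤ⟦X⟧ where
  toFun f := mk fun n => coeff (3 * n + r) f
  map_add' f g := by ext n; simp
  map_smul' c f := by
    ext n
    rw [RingHom.id_apply, map_smul, coeff_mk, map_smul, coeff_mk]

theorem coeff_triSection (r n : ℕ) (f : ℤ⟦X⟧) :
    coeff n (triSection r f) = coeff (3 * n + r) f := by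
  simp [triSection]

theorem cubeSubst_X : cubeSubst X = X ^ 3 := expand_X _ _

theorem coeff_X_pow_mul_cubeSubst {r : ℕ} (hr : r < 3) (n : ℕ) (f : ℤ⟦X⟧) :
    coeff n (X ^ r * cubeSubst f) = if n % 3 = r then coeff (n / 3) f else 0 := by
  rw [coeff_X_pow_mul', cubeSubst]
  split_ifs with h1 h2 h2
  · rw [show n - r = 3 * (n / 3) by omega, coeff_expand_mul]
  · rw [coeff_expand_of_not_dvd _ _ _ (by omega)]
  · omega
  · rfl

theorem eq_sum_triSection (f : ℤ⟦X⟧) :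
    f = X ^ 0 * cubeSubst (triSection 0 f) + X ^ 1 * cubeSubst (triSection 1 f) +
      X ^ 2 * cubeSubst (triSection 2 f) := by
  ext n
  simp only [map_add, coeff_X_pow_mul_cubeSubst (show 0 < 3 by norm_num),
    coeff_X_pow_mul_cubeSubst (show 1 < 3 by norm_num),
    coeff_X_pow_mul_cubeSubst (show 2 < 3 by norm_num), coeff_triSection]
  have : n % 3 = 0 ∨ n % 3 = 1 ∨ n % 3 = 2 := by omega
  rcases this with h | h | h
  · simp [h, show 3 * (n / 3) = n by omega]
  · simp [h, show 3 * (n / 3) + 1 = n by omega]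
  · simp [h, show 3 * (n / 3) + 2 = n by omega]

theorem triSection_X_pow_mul_cubeSubst {r s : ℕ} (hr : r < 3) (hs : s < 3) (f : ℤ⟦X⟧) :
    triSection r (X ^ s * cubeSubst f) = if r = s then f else 0 := by
  ext n
  rw [coeff_triSection, coeff_X_pow_mul_cubeSubst hs, show (3 * n + r) % 3 = r by omega,
    show (3 * n + r) / 3 = n by omega]
  split_ifs <;> simp

theorem triSection_cubeSubst_mul {r : ℕ} (hr : r < 3) (g f : ℤ⟦X⟧) :
    triSection r (cubeSubst g * f) = g * triSection r f := by
  conv_lhs => rw [eq_sum_triSection f]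
  rw [show cubeSubst g * (X ^ 0 * cubeSubst (triSection 0 f) + X ^ 1 * cubeSubst (triSection 1 f) +
      X ^ 2 * cubeSubst (triSection 2 f)) = X ^ 0 * cubeSubst (g * triSection 0 f) +
      X ^ 1 * cubeSubst (g * triSection 1 f) + X ^ 2 * cubeSubst (g * triSection 2 f) by
    simp only [map_mul]; ring]
  simp only [map_add, triSection_X_pow_mul_cubeSubst hr (show 0 < 3 by norm_num),
    triSection_X_pow_mul_cubeSubst hr (show 1 < 3 by norm_num),
    triSection_X_pow_mul_cubeSubst hr (show 2 < 3 by norm_num)]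
  interval_cases r <;> simp

theorem triSection_zero_of_dissection {f p₀ p₁ p₂ : ℤ⟦X⟧}
    (h : f = cubeSubst p₀ + X * cubeSubst p₁ + X ^ 2 * cubeSubst p₂) : triSection 0 f = p₀ := by
  have h0 := triSection_X_pow_mul_cubeSubst (r := 0) (s := 0) (by norm_num) (by norm_num) p₀
  have h1 := triSection_X_pow_mul_cubeSubst (r := 0) (s := 1) (by norm_num) (by norm_num) p₁
  have h2 := triSection_X_pow_mul_cubeSubst (r := 0) (s := 2) (by norm_num) (by norm_num) p₂
  simp only [pow_zero, one_mul, pow_one] at h0 h1 h2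
  rw [h, map_add, map_add, h0, h1, h2]
  simp

theorem triSection_zero_X_mul (f : ℤ⟦X⟧) : triSection 0 (X * f) = X * triSection 2 f := by
  refine triSection_zero_of_dissection (p₁ := triSection 0 f) (p₂ := triSection 1 f) ?_
  conv_lhs => rw [eq_sum_triSection f]
  rw [map_mul, cubeSubst_X]
  ring

/-! ### The cubic modular equation and traces of W -/

/-- The Hauptmodul `q (f_3 f_6 / (f_1 f_2))^4`. -/
noncomputable def cubicT : ℤ⟦X⟧ := X * a3Series ^ 4

/-- The series `q f_9 f_18 / (f_1 f_2)`. -/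
noncomputable def cubicW : ℤ⟦X⟧ := X * a3Series * cubeSubst a3Series

theorem cubeSubst_a3Series_mul : cubeSubst a3Series * (qf 3 * qf 6) = cubeSubst (qf 3 * qf 6) := by
  have h := congrArg cubeSubst a3Series_mul
  rw [map_mul] at h
  rw [← h]
  simp only [cubeSubst, map_mul, expand_qf three_ne_zero one_pos, expand_qf three_ne_zero two_pos,
    Nat.reduceMul]

theorem cubicW_mul : cubicW * (qf 1 * qf 2) = X * cubeSubst (qf 3 * qf 6) := by
  rw [← cubeSubst_a3Series_mul, ← a3Series_mul, cubicW]
  ring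

theorem a3Series_ne_zero : a3Series ≠ 0 := by
  intro h
  have := a3Series_mul
  rw [h, zero_mul] at this
  exact mul_ne_zero (qf_ne_zero (by norm_num)) (qf_ne_zero (by norm_num)) this.symm

theorem cubicT_ne_zero : cubicT ≠ 0 := mul_ne_zero X_ne_zero (pow_ne_zero _ a3Series_ne_zero)

/-- The cubic modular equation together with the first two trace computations. -/
theorem cubicW_relations :
    cubicW ^ 3 = cubeSubst cubicT * (1 + 3 * cubicW + 9 * cubicW ^ 2) ∧
      triSection 0 cubicW = 3 * cubicT ∧
      triSection 0 (cubicW ^ 2) = 2 * cubicT + 27 * cubicT ^ 2 := by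
  obtain ⟨a, c, hac, hy⟩ := exists_qf_one_mul_qf_two_dissection
  have hω := Complex.isPrimitiveRoot_exp 3 three_ne_zero
  have hW := cubicW_mul
  have hF3 := cubeSubst_a3Series_mul
  -- The two evaluations of the norm of f_1 f_2 are equated in ℂ⟦X⟧ and descended to ℤ⟦X⟧ by
  -- injectivity.
  have hN0 : cubeSubst (a ^ 3 - X * (qf 3 * qf 6) ^ 3 + X ^ 2 * c ^ 3 +
      3 * X * a * (qf 3 * qf 6) * c) * cubeSubst (qf 3 * qf 6) = (qf 3 * qf 6) ^ 4 := by
    apply toComplexSeries_injective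
    have h1 := cubeNorm_qf hω (show ¬ 3 ∣ 1 by norm_num)
    have h2 := cubeNorm_qf hω (show ¬ 3 ∣ 2 by norm_num)
    have h3 := cubeNorm_dissection hω a (qf 3 * qf 6) c
    rw [← hy, cubeNorm_mul] at h3
    norm_num only at h1 h2
    rw [map_mul, map_pow, map_mul, cubeSubst, ← h3, map_mul, expand_qf three_ne_zero three_pos,
      expand_qf three_ne_zero (show 0 < 6 by norm_num), map_mul, mul_pow, ← h1, ← h2]
    exact mul_mul_mul_comm _ _ _ _
  have hy' : qf 1 * qf 2 = cubeSubst a - X * cubeSubst (qf 3 * qf 6) + X ^ 2 * cubeSubst c := hy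
  have hy0 : qf 1 * qf 2 ≠ 0 := mul_ne_zero (qf_ne_zero one_pos) (qf_ne_zero two_pos)
  have hb0 : qf 3 * qf 6 ≠ 0 := mul_ne_zero (qf_ne_zero three_pos) (qf_ne_zero (by norm_num))
  clear hy hω
  set b := qf 3 * qf 6
  set y := qf 1 * qf 2
  set N := a ^ 3 - X * b ^ 3 + X ^ 2 * c ^ 3 + 3 * X * a * b * c with hNdef
  have heb0 : cubeSubst b ≠ 0 := by
    intro h
    rw [h, mul_zero] at hN0
    exact pow_ne_zero 4 hb0 hN0.symm
  have hNT' : cubeSubst cubicT * cubeSubst N = (X * cubeSubst b) ^ 3 := by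
    apply mul_right_cancel₀ heb0
    rw [mul_assoc, hN0, cubicT, map_mul, map_pow, cubeSubst_X]
    rw [mul_assoc, ← mul_pow, hF3]
    ring
  have hNT : N * cubicT = X * b ^ 3 := by
    have h := congrArg (triSection 0) hNT'
    rw [mul_pow, ← cubeSubst_X, ← map_pow, ← map_mul, ← map_mul] at h
    rw [triSection_zero_of_dissection (p₀ := cubicT * N) (p₁ := 0) (p₂ := 0) (by simp),
      triSection_zero_of_dissection (p₀ := X * b ^ 3) (p₁ := 0) (p₂ := 0) (by simp)] at h
    rw [mul_comm, h]
  have hN : N ≠ 0 := by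
    intro h
    rw [h, zero_mul] at hNT
    exact mul_ne_zero X_ne_zero (pow_ne_zero 3 hb0) hNT.symm
  have hac3 : cubeSubst a * cubeSubst c = -2 * cubeSubst b ^ 2 := by
    rw [← map_mul, hac, map_mul, map_pow, map_neg, map_ofNat]
  -- With β = q b(q^3), y + β = a(q^3) + q^2 c(q^3); cube this and eliminate the product of a and c
  -- by `hac3`. Since W = β/y, dividing by y^3 gives the modular equation.
  have hcub : y ^ 3 + 3 * (X * cubeSubst b) * y ^ 2 + 9 * (X * cubeSubst b) ^ 2 * y =
      cubeSubst N := by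
    rw [hNdef, hy']
    simp only [map_add, map_sub, map_mul, map_pow, map_ofNat, cubeSubst_X]
    linear_combination (3 * X ^ 2 * cubeSubst a + 3 * X ^ 4 * cubeSubst c -
      3 * X ^ 3 * cubeSubst b) * hac3
  set β := X * cubeSubst b with hβ
  -- N(q^3) is divisible by y, so multiplying by it makes W a polynomial in y and β whose dissection
  -- is explicit, while N itself passes through the section.
  have hw1 : cubeSubst N * cubicW = β * y ^ 2 + 3 * β ^ 2 * y + 9 * β ^ 3 := by
    rw [← hcub]
    linear_combination (y ^ 2 + 3 * β * y + 9 * β ^ 2) * hW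
  have hw2 : cubeSubst N * cubicW ^ 2 = β ^ 2 * y + 3 * β ^ 3 + 9 * β ^ 3 * cubicW := by
    linear_combination cubicW * hw1 + (β * y + 3 * β ^ 2) * hW
  have ht1 : triSection 0 cubicW = 3 * cubicT := by
    apply mul_left_cancel₀ hN
    rw [← triSection_cubeSubst_mul (by norm_num), hw1,
      triSection_zero_of_dissection (p₀ := 3 * (X * b ^ 3)) (p₁ := b * a ^ 2 + X * b ^ 2 * c)
        (p₂ := a * b ^ 2 + X * b * c ^ 2)]
    · linear_combination -3 * hNT
    · rw [hβ, hy']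
      simp only [map_add, map_mul, map_pow, map_ofNat, cubeSubst_X]
      linear_combination 2 * X ^ 3 * cubeSubst b * hac3
  refine ⟨?_, ht1, ?_⟩
  · apply mul_right_cancel₀ (pow_ne_zero 3 hy0)
    linear_combination (cubicW ^ 2 * y ^ 2 + cubicW * y * β + β ^ 2) * hW - hNT' -
      cubeSubst cubicT * ((3 * y ^ 2 + 9 * y * (cubicW * y + β)) * hW + hcub)
  · apply mul_left_cancel₀ hN
    have hb3 : 3 * β ^ 3 + 9 * β ^ 3 * cubicW =
        cubeSubst (3 * (X * b ^ 3)) * 1 + cubeSubst (9 * (X * b ^ 3)) * cubicW := by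
      simp only [hβ, map_mul, map_pow, map_ofNat, cubeSubst_X]
      ring
    rw [← triSection_cubeSubst_mul (by norm_num), hw2, add_assoc, hb3, map_add, map_add,
      triSection_cubeSubst_mul (by norm_num), triSection_cubeSubst_mul (by norm_num), ht1,
      triSection_zero_of_dissection (p₀ := -(X * b ^ 3)) (p₁ := X * b ^ 2 * c)
        (p₂ := a * b ^ 2),
      triSection_zero_of_dissection (f := 1) (p₀ := 1) (p₁ := 0) (p₂ := 0) (by simp)]
    · linear_combination -(2 + 27 * cubicT) * hNT
    · rw [hβ, hy']
      simp only [map_mul, map_neg, map_pow, cubeSubst_X]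
      ring

/-- The modular equation gives a three-term recurrence with multiplier T = (3T)/3. Only the term in
W^i needs a new factor 3, the coefficients 3 and 9 absorbing the denominator elsewhere; hence one 3
suffices per three steps, well within ⌊i/2⌋. The exponent of 3T is ⌈i/3⌉. -/
theorem exists_triSection_cubicW_pow (i : ℕ) : ∃ r : Polynomial ℤ,
    3 ^ (i / 2) * triSection 0 (cubicW ^ i) =
      (3 * cubicT) ^ ((i + 2) / 3) * Polynomial.aeval (3 * cubicT) r := by
  obtain ⟨hcub, h1, h2⟩ := cubicW_relations
  induction i using Nat.strong_induction_on with
  | _ i ih =>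
    match i with
    | 0 =>
      refine ⟨1, ?_⟩
      rw [triSection_zero_of_dissection (p₀ := 1) (p₁ := 0) (p₂ := 0) (by simp)]
      simp
    | 1 => exact ⟨1, by simp [h1]⟩
    | 2 =>
      refine ⟨2 + 9 * Polynomial.X, ?_⟩
      rw [h2]
      simp only [map_add, map_mul, map_ofNat, Polynomial.aeval_X, Nat.reduceAdd, Nat.reduceDiv]
      ring
    | i + 3 =>
      obtain ⟨r₀, hr₀⟩ := ih i (by omega)
      obtain ⟨r₁, hr₁⟩ := ih (i + 1) (by omega)
      obtain ⟨r₂, hr₂⟩ := ih (i + 2) (by omega)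
      have hrec : triSection 0 (cubicW ^ (i + 3)) = cubicT * (triSection 0 (cubicW ^ i) +
          3 * triSection 0 (cubicW ^ (i + 1)) + 9 * triSection 0 (cubicW ^ (i + 2))) := by
        rw [show cubicW ^ (i + 3) = cubeSubst cubicT * (cubicW ^ i + (3 : ℤ) • cubicW ^ (i + 1) +
          (9 : ℤ) • cubicW ^ (i + 2)) by
            simp only [zsmul_eq_mul, Int.cast_ofNat]; linear_combination cubicW ^ i * hcub,
          triSection_cubeSubst_mul (by norm_num), map_add, map_add, map_smul, map_smul]
        simp only [zsmul_eq_mul, Int.cast_ofNat]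
      -- The `+ 1` is the factor 3 spent on turning T into 3T in the term without coefficient.
      obtain ⟨e₀, he₀⟩ := Nat.exists_eq_add_of_le (show i / 2 + 1 ≤ (i + 3) / 2 by omega)
      obtain ⟨e₁, he₁⟩ := Nat.exists_eq_add_of_le (show (i + 1) / 2 ≤ (i + 3) / 2 by omega)
      obtain ⟨e₂, he₂⟩ := Nat.exists_eq_add_of_le (show (i + 2) / 2 ≤ (i + 3) / 2 by omega)
      obtain ⟨d₁, hd₁⟩ := Nat.exists_eq_add_of_le (show (i + 2) / 3 ≤ (i + 1 + 2) / 3 by omega)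
      obtain ⟨d₂, hd₂⟩ := Nat.exists_eq_add_of_le (show (i + 2) / 3 ≤ (i + 2 + 2) / 3 by omega)
      refine ⟨3 ^ e₀ * r₀ + 3 ^ e₁ * Polynomial.X ^ d₁ * r₁ +
        3 * 3 ^ e₂ * Polynomial.X ^ d₂ * r₂, ?_⟩
      rw [hd₁] at hr₁
      rw [hd₂] at hr₂
      rw [show (i + 3 + 2) / 3 = (i + 2) / 3 + 1 by omega, hrec]
      simp only [map_add, map_mul, map_pow, map_ofNat, Polynomial.aeval_X]
      set S := 3 * cubicT
      have k₀ : (3 : ℤ⟦X⟧) ^ ((i + 3) / 2) = 3 * 3 ^ e₀ * 3 ^ (i / 2) := by rw [he₀]; ring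
      have k₁ : (3 : ℤ⟦X⟧) ^ ((i + 3) / 2) = 3 ^ e₁ * 3 ^ ((i + 1) / 2) := by rw [he₁]; ring
      have k₂ : (3 : ℤ⟦X⟧) ^ ((i + 3) / 2) = 3 ^ e₂ * 3 ^ ((i + 2) / 2) := by rw [he₂]; ring
      calc _ = cubicT * (3 ^ ((i + 3) / 2) * triSection 0 (cubicW ^ i) +
            3 * (3 ^ ((i + 3) / 2) * triSection 0 (cubicW ^ (i + 1))) +
            9 * (3 ^ ((i + 3) / 2) * triSection 0 (cubicW ^ (i + 2)))) := by ring
        _ = cubicT * (3 * 3 ^ e₀ * (3 ^ (i / 2) * triSection 0 (cubicW ^ i)) +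
            3 * (3 ^ e₁ * (3 ^ ((i + 1) / 2) * triSection 0 (cubicW ^ (i + 1)))) +
            9 * (3 ^ e₂ * (3 ^ ((i + 2) / 2) * triSection 0 (cubicW ^ (i + 2))))) := by
          congr 2
          · congr 1
            · rw [k₀]; ring
            · rw [k₁]; ring
          · rw [k₂]; ring
        _ = _ := by rw [hr₀, hr₁, hr₂]; simp only [S]; ring

/-- W^(4j+1) is q A T^j times a series in q^3, and the extra q turns the section 3n into 3n+2. -/
theorem cubicT_pow_mul_triSection_two (j : ℕ) :
    cubicT ^ (j + 1) * triSection 2 (a3Series * cubicT ^ j) =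
      a3Series ^ 3 * triSection 0 (cubicW ^ (4 * j + 1)) := by
  have h : cubicW ^ (4 * j + 1) = cubeSubst (X ^ j * a3Series ^ (4 * j + 1)) *
      (X * (a3Series * cubicT ^ j)) := by
    simp only [cubicW, cubicT, map_mul, map_pow, cubeSubst_X, mul_pow, ← pow_mul]
    ring
  rw [h, triSection_cubeSubst_mul (by norm_num), triSection_zero_X_mul]
  set f := triSection 2 (a3Series * cubicT ^ j)
  simp only [cubicT, mul_pow, ← pow_mul]
  ring

theorem cubicT_pow_mul_triSection_zero (j : ℕ) :
    cubicT ^ (j + 1) * triSection 0 (a3Series ^ 3 * cubicT ^ j) =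
      a3Series * triSection 0 (cubicW ^ (4 * j + 3)) := by
  have h : cubicW ^ (4 * j + 3) = cubeSubst (X ^ (j + 1) * a3Series ^ (4 * j + 3)) *
      (a3Series ^ 3 * cubicT ^ j) := by
    simp only [cubicW, cubicT, map_mul, map_pow, cubeSubst_X, mul_pow, ← pow_mul]
    ring
  rw [h, triSection_cubeSubst_mul (by norm_num)]
  set f := triSection 0 (a3Series ^ 3 * cubicT ^ j)
  simp only [cubicT, mul_pow, ← pow_mul]
  ring

theorem exists_map_mul_aeval {L : ℤ⟦X⟧ →ₗ[ℤ] ℤ⟦X⟧} {F G S : ℤ⟦X⟧}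
    (hL : ∀ j : ℕ, ∃ r : Polynomial ℤ, L (F * S ^ j) = G * Polynomial.aeval S r)
    (h : Polynomial ℤ) : ∃ r : Polynomial ℤ,
      L (F * Polynomial.aeval S h) = G * Polynomial.aeval S r := by
  induction h using Polynomial.induction_on' with
  | add p q hp hq =>
    obtain ⟨r, hr⟩ := hp
    obtain ⟨s, hs⟩ := hq
    exact ⟨r + s, by rw [map_add, mul_add, map_add, hr, hs, map_add, mul_add]⟩
  | monomial n c =>
    obtain ⟨r, hr⟩ := hL n
    refine ⟨c • r, ?_⟩
    rw [Polynomial.aeval_monomial, ← Algebra.smul_def, mul_smul_comm, map_smul, hr, map_smul,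
      mul_smul_comm]

theorem three_ne_zero_series : (3 : ℤ⟦X⟧) ≠ 0 := fun h => by
  have := congrArg constantCoeff h
  rw [map_ofNat, map_zero] at this
  norm_num at this

/-- On (3T)^j the trace of W^(4j+1) costs 3^(2j) and supplies (3T)^(j+1): the j factors already in
(3T)^j leave a surplus of exactly one 3. -/
theorem exists_triSection_two_eq (h : Polynomial ℤ) : ∃ r : Polynomial ℤ,
    triSection 2 (a3Series * Polynomial.aeval (3 * cubicT) h) =
      3 * a3Series ^ 3 * Polynomial.aeval (3 * cubicT) r := by
  refine exists_map_mul_aeval (fun j => ?_) h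
  obtain ⟨r, hr⟩ := exists_triSection_cubicW_pow (4 * j + 1)
  obtain ⟨e, he⟩ := Nat.exists_eq_add_of_le (show j + 1 ≤ (4 * j + 1 + 2) / 3 by omega)
  refine ⟨Polynomial.X ^ e * r, ?_⟩
  rw [he, show (4 * j + 1) / 2 = j + j by omega] at hr
  have key := cubicT_pow_mul_triSection_two j
  have h3 : a3Series * (3 * cubicT) ^ j = ((3 : ℤ) ^ j) • (a3Series * cubicT ^ j) := by
    simp only [zsmul_eq_mul, Int.cast_pow, Int.cast_ofNat]; ring
  rw [h3, map_smul]
  simp only [zsmul_eq_mul, Int.cast_pow, Int.cast_ofNat, map_mul, map_pow, Polynomial.aeval_X]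
  have h30 : (3 : ℤ⟦X⟧) ^ j ≠ 0 := pow_ne_zero _ three_ne_zero_series
  apply mul_left_cancel₀ (mul_ne_zero h30 (pow_ne_zero (j + 1) cubicT_ne_zero))
  set Q := Polynomial.aeval (3 * cubicT) r
  have e1 : (3 : ℤ⟦X⟧) ^ j * cubicT ^ (j + 1) * (3 * a3Series ^ 3 * ((3 * cubicT) ^ e * Q)) =
      a3Series ^ 3 * ((3 * cubicT) ^ (j + 1 + e) * Q) := by
    rw [pow_add (3 * cubicT) (j + 1), mul_pow 3 cubicT (j + 1)]
    ring
  rw [e1, ← hr]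
  linear_combination (3 : ℤ⟦X⟧) ^ j * 3 ^ j * key

/-- The same count with W^(4j+3), whose cost 3^(2j+1) uses up the surplus, so integrality remains
but no factor 3. -/
theorem exists_triSection_zero_eq (h : Polynomial ℤ) : ∃ r : Polynomial ℤ,
    triSection 0 (a3Series ^ 3 * Polynomial.aeval (3 * cubicT) h) =
      a3Series * Polynomial.aeval (3 * cubicT) r := by
  refine exists_map_mul_aeval (fun j => ?_) h
  obtain ⟨r, hr⟩ := exists_triSection_cubicW_pow (4 * j + 3)
  obtain ⟨e, he⟩ := Nat.exists_eq_add_of_le (show j + 1 ≤ (4 * j + 3 + 2) / 3 by omega)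
  refine ⟨Polynomial.X ^ e * r, ?_⟩
  rw [he, show (4 * j + 3) / 2 = j + (j + 1) by omega] at hr
  have key := cubicT_pow_mul_triSection_zero j
  have h3 : a3Series ^ 3 * (3 * cubicT) ^ j = ((3 : ℤ) ^ j) • (a3Series ^ 3 * cubicT ^ j) := by
    simp only [zsmul_eq_mul, Int.cast_pow, Int.cast_ofNat]; ring
  rw [h3, map_smul]
  simp only [zsmul_eq_mul, Int.cast_pow, Int.cast_ofNat, map_mul, map_pow, Polynomial.aeval_X]
  have h30 : (3 : ℤ⟦X⟧) ^ (j + 1) ≠ 0 := pow_ne_zero _ three_ne_zero_series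
  apply mul_left_cancel₀ (mul_ne_zero h30 (pow_ne_zero (j + 1) cubicT_ne_zero))
  set Q := Polynomial.aeval (3 * cubicT) r
  have e1 : (3 : ℤ⟦X⟧) ^ (j + 1) * cubicT ^ (j + 1) * (a3Series * ((3 * cubicT) ^ e * Q)) =
      a3Series * ((3 * cubicT) ^ (j + 1 + e) * Q) := by
    rw [pow_add (3 * cubicT) (j + 1), mul_pow 3 cubicT (j + 1)]
    ring
  rw [e1, ← hr]
  linear_combination (3 : ℤ⟦X⟧) ^ (j + 1) * 3 ^ j * key

/-! ### Iteration and the congruences -/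

/-- The generating functions along the progressions `9^α n + (9^α - 1)/4` and
`3 * 9^α n + (9^{α+1} - 1)/4`. -/
theorem exists_generating_functions (α : ℕ) : ∃ d : ℕ, 4 * d + 1 = 9 ^ α ∧
    (∃ h : Polynomial ℤ, (mk fun n => a3 (9 ^ α * n + d)) =
      3 ^ α * (a3Series * Polynomial.aeval (3 * cubicT) h)) ∧
    ∃ h : Polynomial ℤ, (mk fun n => a3 (3 * 9 ^ α * n + (9 * d + 2))) =
      3 ^ (α + 1) * (a3Series ^ 3 * Polynomial.aeval (3 * cubicT) h) := by
  have hpow : ∀ (k r : ℕ) (f : ℤ⟦X⟧), triSection r (3 ^ k * f) = 3 ^ k * triSection r f := by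
    intro k r f
    rw [show (3 : ℤ⟦X⟧) ^ k * f = ((3 : ℤ) ^ k) • f by simp [zsmul_eq_mul], map_smul]
    simp [zsmul_eq_mul]
  have odd_of_even : ∀ α d : ℕ, 4 * d + 1 = 9 ^ α → (∃ h : Polynomial ℤ,
      (mk fun n => a3 (9 ^ α * n + d)) =
        3 ^ α * (a3Series * Polynomial.aeval (3 * cubicT) h)) →
      ∃ h : Polynomial ℤ, (mk fun n => a3 (3 * 9 ^ α * n + (9 * d + 2))) =
        3 ^ (α + 1) * (a3Series ^ 3 * Polynomial.aeval (3 * cubicT) h) := by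
    rintro α d hd ⟨h, hh⟩
    obtain ⟨r, hr⟩ := exists_triSection_two_eq h
    refine ⟨r, ?_⟩
    have := congrArg (triSection 2) hh
    rw [hpow, hr] at this
    rw [show (3 : ℤ⟦X⟧) ^ (α + 1) * (a3Series ^ 3 * Polynomial.aeval (3 * cubicT) r) =
      3 ^ α * (3 * a3Series ^ 3 * Polynomial.aeval (3 * cubicT) r) by ring, ← this]
    ext n
    -- The new offset is 2·9^α + d = 2(4d+1) + d = 9d + 2.
    rw [coeff_triSection, coeff_mk, coeff_mk, ← hd]
    congr 1
    ring
  induction α with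
  | zero =>
    have h0 : ∃ h : Polynomial ℤ, (mk fun n => a3 (9 ^ 0 * n + 0)) =
        3 ^ 0 * (a3Series * Polynomial.aeval (3 * cubicT) h) :=
      ⟨1, by ext n; simp [a3]⟩
    exact ⟨0, rfl, h0, odd_of_even 0 0 rfl h0⟩
  | succ α ih =>
    obtain ⟨d, hd, -, h, hh⟩ := ih
    have hd' : 4 * (9 * d + 2) + 1 = 9 ^ (α + 1) := by rw [pow_succ, ← hd]; ring
    have h1 : ∃ h : Polynomial ℤ, (mk fun n => a3 (9 ^ (α + 1) * n + (9 * d + 2))) =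
        3 ^ (α + 1) * (a3Series * Polynomial.aeval (3 * cubicT) h) := by
      obtain ⟨r, hr⟩ := exists_triSection_zero_eq h
      refine ⟨r, ?_⟩
      have := congrArg (triSection 0) hh
      rw [hpow, hr] at this
      rw [← this]
      ext n
      rw [coeff_triSection, coeff_mk, coeff_mk]
      congr 1
      ring
    exact ⟨9 * d + 2, hd', h1, odd_of_even _ _ hd' h1⟩

theorem three_dvd_coeff_cube (f : ℤ⟦X⟧) {n : ℕ} (hn : ¬ 3 ∣ n) : 3 ∣ coeff n (f ^ 3) := by
  have key : ∃ g u : ℤ⟦X⟧, f ^ 3 = cubeSubst g + (3 : ℤ) • u := by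
    obtain ⟨p, q, r, h⟩ : ∃ p q r, f = cubeSubst p + X * cubeSubst q + X ^ 2 * cubeSubst r :=
      ⟨_, _, _, by simpa using eq_sum_triSection f⟩
    refine ⟨p ^ 3 + X * q ^ 3 + X ^ 2 * r ^ 3,
      cubeSubst p ^ 2 * (X * cubeSubst q + X ^ 2 * cubeSubst r) +
      cubeSubst p * (X * cubeSubst q + X ^ 2 * cubeSubst r) ^ 2 +
      (X * cubeSubst q) * (X ^ 2 * cubeSubst r) * (X * cubeSubst q + X ^ 2 * cubeSubst r), ?_⟩
    rw [h]
    simp only [map_add, map_mul, map_pow, cubeSubst_X, zsmul_eq_mul, Int.cast_ofNat]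
    ring
  obtain ⟨g, u, h⟩ := key
  rw [h, map_add, map_smul, cubeSubst, coeff_expand_of_not_dvd _ _ _ hn, zero_add, smul_eq_mul]
  exact dvd_mul_right _ _

theorem dvd_coeff_of_eq_mul {f g : ℤ⟦X⟧} {k : ℕ} (h : f = 3 ^ k * g) (n : ℕ) :
    3 ^ k ∣ coeff n f := by
  rw [h, show (3 : ℤ⟦X⟧) ^ k * g = ((3 : ℤ) ^ k) • g by simp [zsmul_eq_mul], map_smul, smul_eq_mul]
  exact dvd_mul_right _ _

/-- Modulo 3 only the constant term of the polynomial survives, and a cube is a series in q^3. -/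
theorem pow_succ_dvd_coeff {f F S : ℤ⟦X⟧} {h : Polynomial ℤ} {k n : ℕ}
    (hf : f = 3 ^ k * (F ^ 3 * Polynomial.aeval (3 * S) h)) (hn : ¬ 3 ∣ n) :
    3 ^ (k + 1) ∣ coeff n f := by
  obtain ⟨u, hu⟩ : ∃ u : ℤ⟦X⟧, Polynomial.aeval (3 * S) h = (h.coeff 0 : ℤ⟦X⟧) + 3 * u := by
    conv => enter [1, u]; rw [← Polynomial.divX_mul_X_add h]
    refine ⟨Polynomial.aeval (3 * S) h.divX * S, ?_⟩
    simp
    ring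
  obtain ⟨c, hc⟩ := three_dvd_coeff_cube F hn
  have hf' : f = ((3 : ℤ) ^ k * h.coeff 0) • F ^ 3 + ((3 : ℤ) ^ (k + 1)) • (F ^ 3 * u) := by
    rw [hf, hu]
    simp only [zsmul_eq_mul, Int.cast_mul, Int.cast_pow, Int.cast_ofNat]
    ring
  rw [hf', map_add, map_smul, map_smul, hc, smul_eq_mul, smul_eq_mul]
  exact ⟨h.coeff 0 * c + coeff n (F ^ 3 * u), by ring⟩

theorem theorem1 (α n : ℕ) :
    a3 (3 ^ (2 * α) * n + (3 ^ (2 * α) - 1) / 4) ≡ 0 [ZMOD 3 ^ α] ∧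
    a3 (3 ^ (2 * α + 1) * n + (3 ^ (2 * α + 2) - 1) / 4) ≡ 0 [ZMOD 3 ^ (α + 1)] ∧
    a3 (3 ^ (2 * α + 2) * n + (7 * 3 ^ (2 * α + 1) - 1) / 4) ≡ 0 [ZMOD 3 ^ (α + 2)] ∧
    a3 (3 ^ (2 * α + 2) * n + (11 * 3 ^ (2 * α + 1) - 1) / 4) ≡ 0 [ZMOD 3 ^ (α + 2)] := by
  obtain ⟨d, hd, ⟨g, hg⟩, h, hh⟩ := exists_generating_functions α
  have p0 : 3 ^ (2 * α) = 4 * d + 1 := by rw [pow_mul, hd]; norm_num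
  have p1 : 3 ^ (2 * α + 1) = 3 * (4 * d + 1) := by rw [pow_succ, p0, mul_comm]
  have p2 : 3 ^ (2 * α + 2) = 9 * (4 * d + 1) := by rw [pow_add, p0, mul_comm]; rfl
  have q0 : (4 * d + 1 - 1) / 4 = d := by omega
  have q1 : (9 * (4 * d + 1) - 1) / 4 = 9 * d + 2 := by omega
  have q2 : (7 * (3 * (4 * d + 1)) - 1) / 4 = 21 * d + 5 := by omega
  have q3 : (11 * (3 * (4 * d + 1)) - 1) / 4 = 33 * d + 8 := by omega
  simp only [p0, p1, p2, q0, q1, q2, q3, Int.modEq_zero_iff_dvd]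
  rw [← hd] at hg hh
  refine ⟨?_, ?_, ?_, ?_⟩
  · simpa using dvd_coeff_of_eq_mul hg n
  · simpa using dvd_coeff_of_eq_mul hh n
  -- The last two progressions are the terms of index 3n+1 and 3n+2 of the second one: 3(4d+1) +
  -- 9d+2 = 21d+5 and 6(4d+1) + 9d+2 = 33d+8.
  · have := pow_succ_dvd_coeff hh (show ¬ 3 ∣ 3 * n + 1 by omega)
    rw [coeff_mk] at this
    convert this using 2
    ring
  · have := pow_succ_dvd_coeff hh (show ¬ 3 ∣ 3 * n + 2 by omega)
    rw [coeff_mk] at this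
    convert this using 2
    ring
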